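/- Let $K$ be a field, let $R$ be a unital associative $K$-algebra, let $\sigma:R\to R$ be a $K$-algebra endomorphism, and let $t\ge 1$ be an integer with $\sigma^{t}=1$. Let $R[w,\sigma]$ be the skew polynomial algebra, whose elements are the left polynomials $r_0+r_1w+\cdots+r_kw^k$ with $r_i\in R$, multiplied according to the rule $wr=\sigma(r)w$ for $r\in R$, and let $(w^t)$ be its two-sided ideal generated by $w^t$. Call a $K$-algebra $A$ a PI-algebra if there is a nonzero element $f$ of the free associative algebra $K\langle x_1,x_2,\ldots\rangle$ such that $f(a_1,a_2,\ldots)=0$ for all $a_1,a_2,\ldots\in A$. If $R$ is a PI-algebra, then for every integer $n\ge 1$ the full matrix algebra $\mathrm{M}_n(R[w,\sigma]/(w^t))$ is a PI-algebra. In particular, $R[w,\sigma]/(w^t)$ is a PI-algebra. -/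

import Mathlib

section SkewPolynomials

variable {K R : Type*} [Field K] [Ring R] [Algebra K R]

/-- A copy of the `K`-algebra `R` that remembers an endomorphism `σ` of `R`: the monoid `ℕ`
acts on it through the powers of `σ`, which is how `SkewPolynomial` is told which endomorphism
twists the multiplication. -/
def TwistedBy (_σ : R →ₐ[K] R) : Type _ := R

instance (σ : R →ₐ[K] R) : Ring (TwistedBy σ) := inferInstanceAs (Ring R)

instance (σ : R →ₐ[K] R) : Algebra K (TwistedBy σ) := inferInstanceAs (Algebra K R)

/-- The identity map from `R` to its copy `TwistedBy σ`. -/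
def TwistedBy.of (σ : R →ₐ[K] R) : R ≃ₐ[K] TwistedBy σ := AlgEquiv.refl (R := K) (A₁ := R)

instance (σ : R →ₐ[K] R) : MulSemiringAction (Multiplicative ℕ) (TwistedBy σ) where
  smul n r := TwistedBy.of σ ((σ ^ n.toAdd) ((TwistedBy.of σ).symm r))
  one_smul _ := rfl
  mul_smul m n r :=
    congrArg (fun f : R →ₐ[K] R => TwistedBy.of σ (f ((TwistedBy.of σ).symm r)))
      (pow_add σ m.toAdd n.toAdd)
  smul_zero n := map_zero (σ ^ n.toAdd)
  smul_add n := map_add (σ ^ n.toAdd)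
  smul_one n := map_one (σ ^ n.toAdd)
  smul_mul n := map_mul (σ ^ n.toAdd)

instance (σ : R →ₐ[K] R) : SMulCommClass (Multiplicative ℕ) K (TwistedBy σ) where
  smul_comm n k r := map_smul (σ ^ n.toAdd) k ((TwistedBy.of σ).symm r)

/-- The skew polynomial algebra `R[w, σ]`: left polynomials `r₀ + r₁ w + ⋯ + r_k w ^ k` with
`w r = σ(r) w`. -/
abbrev SkewPolyAlg (σ : R →ₐ[K] R) : Type _ := SkewPolynomial (TwistedBy σ)

/-- The defining relation `w r = σ(r) w` of `R[w, σ]`. -/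
theorem SkewPolyAlg.X_mul_C (σ : R →ₐ[K] R) (r : R) :
    (SkewPolynomial.X * SkewPolynomial.C (TwistedBy.of σ r) : SkewPolyAlg σ) =
      SkewPolynomial.C (TwistedBy.of σ (σ r)) * SkewPolynomial.X := by
  have h : (SkewPolynomial.φ (TwistedBy.of σ r) : TwistedBy σ) = TwistedBy.of σ (σ r) :=
    congrArg (fun f : R →ₐ[K] R => TwistedBy.of σ (f r)) (pow_one σ)
  rw [← SkewPolynomial.monomial_zero_left, ← SkewPolynomial.monomial_zero_left,
    SkewPolynomial.X_mul_monomial, SkewPolynomial.monomial_mul_X, h]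

/-- The truncated skew polynomial algebra `R[w, σ] / (w ^ t)`, the quotient of `R[w, σ]` by the
two-sided ideal generated by `w ^ t`. -/
abbrev TruncSkewPolyAlg (σ : R →ₐ[K] R) (t : ℕ) : Type _ :=
  (TwoSidedIdeal.span {(SkewPolynomial.X ^ t : SkewPolyAlg σ)}).ringCon.Quotient

end SkewPolynomials

/-- A `K`-algebra `A` is a PI-algebra if some nonzero element of the free associative algebra
`K⟨x₀, x₁, …⟩` vanishes under every substitution of elements of `A` for the indeterminates. -/
def IsPIAlgebra (K A : Type*) [Field K] [Ring A] [Algebra K A] : Prop :=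
  ∃ f : FreeAlgebra K ℕ, f ≠ 0 ∧ ∀ a : ℕ → A, FreeAlgebra.lift K a f = 0

/-!
Let `A = R[w, σ] / (w ^ t)`. The ideal of `A` generated by `w` satisfies `(w) ^ t = 0`, and every
element of `A` is congruent to a constant modulo `(w)`. If `f` is an identity of `R`, then the values
of `f` on `A` lie in `(w)`, so that `f ^ t` vanishes on `A`; it is nonzero because the free algebra
is a domain. Hence `A` is a PI-algebra (`IsPIAlgebra.truncSkewPolyAlg`).

It remains that matrix algebras over a PI-algebra `A` are PI-algebras. This is the special case of a
matrix factor in Regev's theorem on tensor products, and it is proved here for every tensor product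
`B ⊗ A` with `B` finite-dimensional (`IsPIAlgebra.tensorProduct`), by Regev's comparison of
codimensions with factorials:

* `A` satisfies a multilinear identity of some degree `d`
  (`IsPIAlgebra.exists_isMultilinearIdentity`);
* modulo this identity every multilinear monomial of degree `n` is a combination of monomials
  belonging to permutations without decreasing subsequences of length `d`
  (`IsMultilinearIdentity.prod_mem_span`), of which there are at most `d ^ (2 * n)`
  (`card_isGood_perm_le`);
* thus a multilinear polynomial of degree `n` is an identity of `B ⊗ A` as soon as its `n!`
  coefficients satisfy at most `dim B * (dim B * d ^ 2) ^ n` homogeneous linear equations, and for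
  large `n` there are fewer equations than coefficients.
-/

/-! ### Multilinearization -/

/-- The value of `f ∈ K⟨X⟩` at `a`, written out as a sum over the words occurring in `f`. -/
theorem FreeAlgebra.lift_apply_eq_sum {K A X : Type*} [CommSemiring K] [Semiring A] [Algebra K A]
    (a : X → A) (f : FreeAlgebra K X) :
    FreeAlgebra.lift K a f = (FreeAlgebra.equivMonoidAlgebraFreeMonoid f).coeff.sum
      fun v c => c • (v.toList.map a).prod := by
  have h : FreeAlgebra.lift K a = (MonoidAlgebra.lift K A (FreeMonoid X) (FreeMonoid.lift a)).comp
      (FreeAlgebra.equivMonoidAlgebraFreeMonoid (R := K) (X := X)).toAlgHom := by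
    ext x
    simp [FreeAlgebra.equivMonoidAlgebraFreeMonoid]
  rw [h]
  simp [MonoidAlgebra.lift_apply, FreeMonoid.lift_apply]

theorem List.prod_ofFn_ite {A : Type*} [MonoidWithZero A] {n : ℕ} (P : Fin n → Prop)
    [DecidablePred P] (b : Fin n → A) :
    (List.ofFn fun k => if P k then b k else 0).prod =
      if ∀ k, P k then (List.ofFn b).prod else 0 := by
  split_ifs with h
  · simp [h]
  · obtain ⟨k, hk⟩ := not_forall.mp h
    exact List.prod_eq_zero ((List.mem_ofFn' _ _).mpr ⟨k, by simp [hk]⟩)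

/-- Distributivity for an ordered product of finite sums. -/
theorem List.prod_ofFn_sum {A ι : Type*} [Semiring A] [Fintype ι] {n : ℕ}
    (g : Fin n → ι → A) :
    (List.ofFn fun k => ∑ i, g k i).prod = ∑ q : Fin n → ι, (List.ofFn fun k => g k (q k)).prod := by
  classical
  simpa using (MultilinearMap.mkPiAlgebraFin ℕ n A).map_sum g

theorem Finset.sum_neg_one_pow_card_of_subset {α : Type*} [Fintype α] [DecidableEq α]
    (T : Finset α) :
    ∑ S : Finset α, (if T ⊆ S then (-1 : ℤ) ^ S.card else 0) =
      if T = Finset.univ then (-1) ^ Fintype.card α else 0 := by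
  split_ifs with h
  · subst h
    simp [Finset.univ_subset_iff]
  · -- toggling membership of a point outside `T` is a sign-reversing involution
    obtain ⟨p, hp⟩ : ∃ p, p ∉ T := by simpa [Finset.eq_univ_iff_forall] using h
    refine Finset.sum_involution (fun S _ => if p ∈ S then S.erase p else insert p S) ?_ ?_ ?_ ?_
    · intro S _
      by_cases hS : p ∈ S
      · have : T ⊆ S.erase p ↔ T ⊆ S :=
          ⟨fun h => h.trans (Finset.erase_subset _ _), fun h => Finset.subset_erase.mpr ⟨h, hp⟩⟩
        have h2 := Finset.card_erase_add_one hS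
        simp only [hS, if_true, this]
        split_ifs
        · rw [← h2, pow_succ]; ring
        · simp
      · have : T ⊆ insert p S ↔ T ⊆ S := by
          rw [Finset.subset_insert_iff_of_notMem hp]
        simp only [hS, if_false, this]
        split_ifs
        · rw [Finset.card_insert_of_notMem hS, pow_succ]; ring
        · simp
    · intro S _ _
      by_cases hS : p ∈ S
      · simp only [hS, if_true]
        exact fun h => Finset.erase_eq_self.mp h hS
      · simp only [hS, if_false]
        exact fun h => hS (h ▸ Finset.mem_insert_self p S)
    · simp
    · intro S _
      by_cases hS : p ∈ S
      · simp [hS, Finset.insert_erase hS]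
      · simp [hS]

/-- Polarization of a single monomial. Let `W` be a word of length `d`, and for a set `S` of
positions substitute for the letter `x` the sum of the `b p` over those `p ∈ S` with `W p = x`. In
the alternating sum over `S` of the values of a word `V` of length at most `d`, only the products
in which every `b p` occurs survive; they are the `b (π 0) ⋯ b (π (d - 1))` for the permutations
`π` of positions that carry `W` to `V`. -/
theorem sum_neg_one_pow_card_prod_ofFn {A X : Type*} [Ring A] [DecidableEq X] {d e : ℕ}
    (he : e ≤ d)
    (W : Fin d → X) (V : Fin e → X) (b : Fin d → A) :
    ∑ S : Finset (Fin d), (-1 : ℤ) ^ S.card •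
        (List.ofFn fun k => ∑ p, if p ∈ S ∧ W p = V k then b p else 0).prod =
      (-1 : ℤ) ^ d • ∑ π : Equiv.Perm (Fin d),
        if List.ofFn (W ∘ π) = List.ofFn V then (List.ofFn (b ∘ π)).prod else 0 := by
  -- `q` chooses which summand is taken from each factor
  have key : ∀ q : Fin e → Fin d, (∑ S : Finset (Fin d), (-1 : ℤ) ^ S.card •
      if (∀ k, q k ∈ S ∧ W (q k) = V k) then (List.ofFn (b ∘ q)).prod else 0) =
      (-1 : ℤ) ^ d • if Function.Surjective q ∧ W ∘ q = V then (List.ofFn (b ∘ q)).prod else 0 := by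
    intro q
    by_cases hV : W ∘ q = V
    · have h := congrArg (fun z : ℤ => z • (List.ofFn (b ∘ q)).prod)
        (Finset.sum_neg_one_pow_card_of_subset (Finset.univ.image q))
      simp only [Finset.sum_smul, ite_smul, zero_smul, Fintype.card_fin] at h
      simp only [smul_ite, smul_zero, hV, and_true]
      convert! h using 1
      · refine Finset.sum_congr rfl fun S _ => if_congr ?_ rfl rfl
        rw [← hV]
        simp [Finset.subset_iff]
      · refine if_congr ?_ rfl rfl
        simp [Finset.eq_univ_iff_forall, Function.Surjective]
    · have : ∀ S : Finset (Fin d), ¬ ∀ k, q k ∈ S ∧ W (q k) = V k :=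
        fun S h => hV (funext fun k => (h k).2)
      simp [this, hV]
  simp_rw [List.prod_ofFn_sum, List.prod_ofFn_ite, Finset.smul_sum]
  rw [Finset.sum_comm]
  refine (Finset.sum_congr rfl fun q _ => key q).trans ?_
  rw [← Finset.smul_sum, ← Finset.smul_sum]
  congr 1
  rcases he.lt_or_eq with he | rfl
  · rw [Finset.sum_eq_zero, Finset.sum_eq_zero]
    · intro π _
      rw [if_neg]
      intro h
      have := congrArg List.length h
      simp at this
      omega
    · intro q _
      rw [if_neg]
      rintro ⟨h, -⟩
      have := Fintype.card_le_of_surjective q h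
      simp at this
      omega
  · symm
    rw [← Finset.sum_subset (Finset.subset_univ (Finset.univ.map
      ⟨fun π : Equiv.Perm (Fin e) => (π : Fin e → Fin e), DFunLike.coe_injective⟩))]
    · rw [Finset.sum_map]
      refine Finset.sum_congr rfl fun π _ => if_congr ?_ rfl rfl
      simp [List.ofFn_inj, π.surjective]
    · intro q _ hq
      rw [if_neg]
      rintro ⟨h, -⟩
      exact hq (Finset.mem_map.mpr ⟨Equiv.ofBijective q (Finite.surjective_iff_bijective.mp h),
        Finset.mem_univ _, rfl⟩)

/-- The multilinear polynomial `∑ π, c π • x (π 0) ⋯ x (π (n - 1))` vanishes identically on the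
`K`-algebra `A`; it is encoded by the family `c` of its coefficients. -/
def IsMultilinearIdentity {K : Type*} (A : Type*) [CommSemiring K] [Semiring A] [Algebra K A]
    {n : ℕ} (c : Equiv.Perm (Fin n) → K) : Prop :=
  ∀ b : Fin n → A, ∑ π, c π • (List.ofFn (b ∘ π)).prod = 0

/-- Multilinearization, over an arbitrary field. Polarizing an identity `f` along a longest word
`w` of `f` gives the multilinear polynomial whose coefficient at `π` is the coefficient in `f` of
the word `w` with its positions permuted by `π`; at `π = 1` this is the coefficient of `w`, so no
characteristic or cardinality assumption is needed for it to be nonzero. -/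
theorem IsPIAlgebra.exists_isMultilinearIdentity {K A : Type*} [Field K] [Ring A] [Algebra K A]
    (h : IsPIAlgebra K A) :
    ∃ (n : ℕ) (c : Equiv.Perm (Fin n) → K), c 1 ≠ 0 ∧ IsMultilinearIdentity A c := by
  classical
  obtain ⟨f, hf, hA⟩ := h
  set F := (FreeAlgebra.equivMonoidAlgebraFreeMonoid f).coeff with hF
  have hF0 : F ≠ 0 := by
    intro h0
    apply hf
    apply FreeAlgebra.equivMonoidAlgebraFreeMonoid.injective
    ext v
    rw [← hF, h0]
    simp
  obtain ⟨w, hw, hmax⟩ := Finset.exists_max_image F.support (fun v => v.toList.length)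
    (Finsupp.support_nonempty_iff.mpr hF0)
  set W : Fin w.toList.length → ℕ := w.toList.get with hW
  refine ⟨w.toList.length, fun π => F (FreeMonoid.ofList (List.ofFn (W ∘ π))), ?_, fun b => ?_⟩
  · simpa [hW] using hw
  have h0 : ∑ S : Finset (Fin w.toList.length), (-1 : ℤ) ^ S.card •
      FreeAlgebra.lift K (fun i => ∑ p, if p ∈ S ∧ W p = i then b p else 0) f = 0 := by
    simp [hA]
  have h1 : ∀ v ∈ F.support, ∑ S : Finset (Fin w.toList.length), (-1 : ℤ) ^ S.card •
      F v • (v.toList.map fun i => ∑ p, if p ∈ S ∧ W p = i then b p else 0).prod =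
      (-1 : ℤ) ^ w.toList.length • ∑ π : Equiv.Perm (Fin w.toList.length),
        if FreeMonoid.ofList (List.ofFn (W ∘ π)) = v then F v • (List.ofFn (b ∘ π)).prod else 0 := by
    intro v hv
    have h := sum_neg_one_pow_card_prod_ofFn (hmax v hv) W v.toList.get b
    have h' := congrArg (F v • ·) h
    simp only [Finset.smul_sum, smul_comm (F v), smul_ite, smul_zero, List.ofFn_get] at h'
    rw [Finset.smul_sum]
    convert! h' using 2 with S _ π
    · congr 3
      conv_lhs => rw [← List.ofFn_get v.toList, List.map_ofFn]
      rfl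
    · rw [smul_ite, smul_zero]
      exact if_congr Iff.rfl rfl rfl
  simp only [FreeAlgebra.lift_apply_eq_sum, ← hF, Finsupp.sum, Finset.smul_sum] at h0
  rw [Finset.sum_comm, Finset.sum_congr rfl h1, ← Finset.smul_sum] at h0
  -- multiplying by the sign once more removes it
  have h2 := congrArg ((-1 : ℤ) ^ w.toList.length • ·) h0
  simp only [smul_smul, ← mul_pow, smul_zero] at h2
  rw [Finset.sum_comm] at h2
  simp only [mul_neg, mul_one, neg_neg, one_pow, one_smul, Finset.sum_ite_eq] at h2
  refine (Finset.sum_congr rfl fun π _ => ?_).trans h2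
  split_ifs with hπ
  · rfl
  · simp [Finsupp.notMem_support_iff.mp hπ]

theorem IsMultilinearIdentity.isPIAlgebra {K A : Type*} [Field K] [Ring A] [Algebra K A] {n : ℕ}
    {c : Equiv.Perm (Fin n) → K} (hc : c ≠ 0) (h : IsMultilinearIdentity A c) :
    IsPIAlgebra K A := by
  classical
  set word : Equiv.Perm (Fin n) → FreeMonoid ℕ :=
    fun π => FreeMonoid.ofList (List.ofFn fun i => (π i : ℕ)) with hword
  have hinj : Function.Injective word := by
    intro π ρ h
    have := List.ofFn_inj.mp (FreeMonoid.ofList.injective h)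
    exact Equiv.ext fun i => Fin.ext (congrFun this i)
  refine ⟨FreeAlgebra.equivMonoidAlgebraFreeMonoid.symm
    (∑ π, MonoidAlgebra.single (word π) (c π)), ?_, fun a => ?_⟩
  · obtain ⟨π, hπ⟩ := Function.ne_iff.mp hc
    intro h0
    rw [map_eq_zero_iff _ (AlgEquiv.injective _)] at h0
    apply hπ
    have := congrArg (fun g : MonoidAlgebra K (FreeMonoid ℕ) => g.coeff (word π)) h0
    simpa [Finsupp.single_apply, hinj.eq_iff] using this
  · rw [map_sum, map_sum]
    refine Eq.trans (Finset.sum_congr rfl fun π _ => ?_) (h fun i => a i)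
    rw [FreeAlgebra.lift_apply_eq_sum, AlgEquiv.apply_symm_apply]
    simp [hword, List.map_ofFn, Function.comp_def]

/-! ### Decreasing subwords -/

/-- A subword `s` of `l` cuts `l` into an initial part `u` and blocks whose first letters are the
letters of `s`. -/
theorem List.Sublist.exists_append_flatten {α : Type*} {s l : List α} (h : s.Sublist l) :
    ∃ (u : List α) (Ls : List (List α)), l = u ++ Ls.flatten ∧ Ls.map List.head? = s.map some := by
  induction h with
  | slnil => exact ⟨[], [], rfl, rfl⟩
  | cons a _ ih =>
    obtain ⟨u, Ls, rfl, h⟩ := ih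
    exact ⟨a :: u, Ls, rfl, h⟩
  | cons_cons a _ ih =>
    obtain ⟨u, Ls, rfl, h⟩ := ih
    exact ⟨[], (a :: u) :: Ls, by simp, by simp [h]⟩

/-- If the first letters of consecutive blocks are strictly decreasing, every nontrivial
rearrangement of the blocks gives a lexicographically smaller word. -/
theorem List.Perm.flatten_lt {α : Type*} [LinearOrder α] {s : List α} (hs : s.Pairwise (· > ·))
    {Ls Ls' : List (List α)} (hd : Ls.map List.head? = s.map some) (hp : Ls'.Perm Ls)
    (hne : Ls' ≠ Ls) : Ls'.flatten < Ls.flatten := by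
  induction Ls generalizing s Ls' with
  | nil => exact absurd hp.eq_nil hne
  | cons L T ih =>
    cases s with
    | nil => simp at hd
    | cons x s =>
      obtain ⟨hL, hT⟩ : L.head? = some x ∧ T.map List.head? = s.map some := by simpa using hd
      rw [List.pairwise_cons] at hs
      cases Ls' with
      | nil => exact absurd hp.symm.eq_nil (by simp)
      | cons L' T' =>
        by_cases hLL : L' = L
        · subst hLL
          have := ih hs.2 hT (List.perm_cons _ |>.mp hp) (fun h => hne (h ▸ rfl))
          simpa using List.append_left_lt this
        · have hmem : L' ∈ T := by
            have : L' ∈ L :: T := hp.subset (by simp)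
            simpa [hLL] using this
          have hy : L'.head? ∈ s.map some := hT ▸ List.mem_map_of_mem hmem
          obtain ⟨y, hys, hyL⟩ := List.mem_map.mp hy
          obtain ⟨L₁, rfl⟩ := List.head?_eq_some_iff.mp hL
          obtain ⟨L₂, rfl⟩ := List.head?_eq_some_iff.mp hyL.symm
          exact List.Lex.rel (hs.1 y hys)

/-- A word without repeated letters can be coloured by `ℕ` such that each colour class is
increasing, the colour of `x` being one less than the length of some decreasing subword that starts
with `x`. -/
theorem List.exists_coloring {α : Type*} [LinearOrder α] {l : List α} (hl : l.Nodup) :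
    ∃ χ : α → ℕ,
      (∀ x ∈ l, ∃ s : List α, (x :: s).Sublist l ∧ (x :: s).Pairwise (· > ·) ∧ s.length = χ x) ∧
      l.Pairwise fun x y => χ x = χ y → x < y := by
  classical
  induction l with
  | nil => exact ⟨fun _ => 0, by simp⟩
  | cons a t ih =>
    rw [List.nodup_cons] at hl
    obtain ⟨χ, hχ, hp⟩ := ih hl.2
    -- the new letter gets the least colour exceeding those of all smaller letters after it
    set m := (t.toFinset.filter (· < a)).sup fun y => χ y + 1 with hm
    have hne : ∀ y ∈ t, y ≠ a := fun y hy h => hl.1 (h ▸ hy)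
    refine ⟨Function.update χ a m, fun x hx => ?_, ?_⟩
    · rcases List.mem_cons.mp hx with rfl | hx
      · rw [Function.update_self]
        rcases (t.toFinset.filter (· < x)).eq_empty_or_nonempty with h0 | h0
        · exact ⟨[], by simp, by simp, by simp [hm, h0]⟩
        · obtain ⟨y, hy, hym⟩ := Finset.exists_mem_eq_sup _ h0 fun y => χ y + 1
          obtain ⟨hyt, hyx⟩ : y ∈ t ∧ y < x := by simpa using hy
          obtain ⟨s, hs, hsp, hsl⟩ := hχ y hyt
          refine ⟨y :: s, hs.cons_cons x, List.pairwise_cons.mpr ⟨fun z hz => ?_, hsp⟩, ?_⟩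
          · rcases List.mem_cons.mp hz with rfl | hz
            · exact hyx
            · exact ((List.pairwise_cons.mp hsp).1 z hz).trans hyx
          · rw [hm, hym, List.length_cons, hsl]
      · obtain ⟨s, hs, hsp, hsl⟩ := hχ x hx
        exact ⟨s, hs.cons a, hsp, by rw [Function.update_of_ne (hne x hx), hsl]⟩
    · rw [List.pairwise_cons]
      refine ⟨fun y hy h => ?_, hp.imp_of_mem fun hx hy h => ?_⟩
      · rw [Function.update_self, Function.update_of_ne (hne y hy)] at h
        by_contra hlt
        have hya : y < a := lt_of_le_of_ne (not_lt.mp hlt) (hne y hy)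
        have : χ y + 1 ≤ m :=
          Finset.le_sup (f := fun y => χ y + 1) (by simpa using ⟨hy, hya⟩)
        omega
      · rwa [Function.update_of_ne (hne _ hx), Function.update_of_ne (hne _ hy)]

/-- A word is determined by its sequence of colours together with its colour classes, each of them
listed in the order of the word. -/
theorem List.eq_of_map_eq_of_filter_eq {α β : Type*} [DecidableEq β] (χ : α → β) {l₁ l₂ : List α}
    (hm : l₁.map χ = l₂.map χ)
    (hf : ∀ c, l₁.filter (fun x => χ x = c) = l₂.filter fun x => χ x = c) : l₁ = l₂ := by
  induction l₁ generalizing l₂ with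
  | nil => exact (List.map_eq_nil_iff.mp hm.symm).symm
  | cons a l₁ ih =>
    cases l₂ with
    | nil => simp at hm
    | cons b l₂ =>
      obtain ⟨hab, hm'⟩ : χ a = χ b ∧ l₁.map χ = l₂.map χ := by simpa using hm
      have h := hf (χ b)
      simp only [List.filter_cons, hab, decide_true, if_true, List.cons.injEq] at h
      obtain ⟨rfl, -⟩ := h
      rw [ih hm' fun c => ?_]
      have h := hf c
      by_cases hc : χ a = c <;> simpa [List.filter_cons, hc] using h

/-- A word is `d`-good if it has no strictly decreasing subword of length `d` (equivalently, of
length at least `d`). -/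
def List.IsGood {α : Type*} [LinearOrder α] (d : ℕ) (l : List α) : Prop :=
  ∀ s : List α, s.Sublist l → s.Pairwise (· > ·) → s.length ≠ d

theorem List.IsGood.exists_coloring {α : Type*} [LinearOrder α] {d : ℕ} {l : List α}
    (hl : l.Nodup) (hg : l.IsGood d) (hall : ∀ x, x ∈ l) :
    ∃ χ : α → Fin d, l.Pairwise fun x y => χ x = χ y → x < y := by
  obtain ⟨χ, hχ, hp⟩ := List.exists_coloring hl
  refine ⟨fun x => ⟨χ x, ?_⟩, by simpa using hp⟩
  obtain ⟨s, hs, hsp, hsl⟩ := hχ x (hall x)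
  by_contra! hlt
  refine hg ((x :: s).take d) ((List.take_sublist _ _).trans hs)
    (hsp.sublist (List.take_sublist _ _)) ?_
  simp [hsl]
  omega

/-- The number of `d`-good permutations of `n` letters grows only exponentially in `n`. Such a
permutation is determined by a colouring of the letters with `d` colours that makes each colour
class increasing and by the resulting sequence of colours. -/
theorem card_isGood_perm_le (n d : ℕ)
    [DecidablePred fun π : Equiv.Perm (Fin n) => (List.ofFn π).IsGood d] :
    Fintype.card {π : Equiv.Perm (Fin n) // (List.ofFn π).IsGood d} ≤ (d ^ 2) ^ n := by
  have hex : ∀ π : {π : Equiv.Perm (Fin n) // (List.ofFn π).IsGood d}, ∃ χ : Fin n → Fin d,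
      (List.ofFn π.1).Pairwise fun x y => χ x = χ y → x < y := fun π =>
    π.2.exists_coloring (List.nodup_ofFn.mpr π.1.injective)
      fun x => (List.mem_ofFn' _ _).mpr (π.1.surjective x)
  choose χ hχ using hex
  have hinj : Function.Injective fun π => (χ π, χ π ∘ π.1) := by
    intro π ρ h
    obtain ⟨h1, h2⟩ := Prod.mk.inj h
    have hχρ := hχ ρ
    rw [← h1] at h2 hχρ
    refine Subtype.ext (DFunLike.coe_injective (List.ofFn_injective
      (List.eq_of_map_eq_of_filter_eq (χ π) ?_ fun c => ?_)))
    · rw [List.map_ofFn, List.map_ofFn, h2]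
    · have hsort : ∀ σ : Equiv.Perm (Fin n),
          ((List.ofFn σ).Pairwise fun x y => χ π x = χ π y → x < y) →
          ((List.ofFn σ).filter fun x => χ π x = c).Pairwise (· < ·) := fun σ hσ =>
        (hσ.filter _).imp_of_mem fun hx hy h => h (by simp_all)
      refine List.Perm.eq_of_pairwise (fun a b _ _ h1 h2 => absurd h1 h2.not_gt)
        (hsort _ (hχ π)) (hsort _ hχρ) (List.Perm.filter _ ?_)
      exact (List.perm_ext_iff_of_nodup (List.nodup_ofFn.mpr π.1.injective)
        (List.nodup_ofFn.mpr ρ.1.injective)).mpr fun x => by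
          simp [List.mem_ofFn', π.1.surjective.range_eq, ρ.1.surjective.range_eq]
  refine (Fintype.card_le_of_injective _ hinj).trans (le_of_eq ?_)
  simp [pow_two, mul_pow]

/-! ### Tensor products with finite-dimensional algebras -/

open scoped TensorProduct

/-- A word in `n` letters, of length `n` and without repetitions, is a permutation. -/
theorem List.exists_perm_ofFn_eq {n : ℕ} {l : List (Fin n)} (hl : l.Nodup) (hn : l.length = n) :
    ∃ ρ : Equiv.Perm (Fin n), List.ofFn ρ = l := by
  obtain ⟨f, rfl⟩ : ∃ f : Fin n → Fin n, List.ofFn f = l :=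
    ⟨fun i => l.get (i.cast hn.symm), List.ext_get (by simp [hn]) (by simp)⟩
  exact ⟨Equiv.ofBijective f (Finite.injective_iff_bijective.mp (List.nodup_ofFn.mp hl)), rfl⟩

/-- Modulo a multilinear identity of degree `d`, every multilinear monomial of degree `n` is a
linear combination of the `d`-good ones. A word that is not `d`-good is cut into `d` blocks with
decreasing first letters; the identity, applied to the values of these blocks, expresses its
monomial through those of lexicographically smaller words. -/
theorem IsMultilinearIdentity.prod_mem_span {K A : Type*} [Field K] [Ring A] [Algebra K A] {d : ℕ}
    {c : Equiv.Perm (Fin d) → K} (hc1 : c 1 ≠ 0) (hc : IsMultilinearIdentity A c) (n : ℕ)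
    (π : Equiv.Perm (Fin n)) :
    (fun r : Fin n → A => (List.ofFn (r ∘ π)).prod) ∈ Submodule.span K
      (Set.range fun (τ : {τ : Equiv.Perm (Fin n) // (List.ofFn τ).IsGood d}) (r : Fin n → A) =>
        (List.ofFn (r ∘ τ.1)).prod) := by
  have hwf : WellFounded fun π ρ : Equiv.Perm (Fin n) => List.ofFn π < List.ofFn ρ :=
    haveI : Std.Irrefl fun π ρ : Equiv.Perm (Fin n) => List.ofFn π < List.ofFn ρ :=
      ⟨fun _ => lt_irrefl _⟩
    haveI : IsTrans _ fun π ρ : Equiv.Perm (Fin n) => List.ofFn π < List.ofFn ρ :=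
      ⟨fun _ _ _ => lt_trans⟩
    Finite.wellFounded_of_trans_of_irrefl _
  induction π using hwf.induction with
  | h π ih =>
  by_cases hg : (List.ofFn π).IsGood d
  · exact Submodule.subset_span ⟨⟨π, hg⟩, rfl⟩
  obtain ⟨s, hs, hsp, hsd⟩ : ∃ s : List (Fin n), s.Sublist (List.ofFn π) ∧
      s.Pairwise (· > ·) ∧ s.length = d := by simpa [List.IsGood] using hg
  obtain ⟨u, Ls, hπ, hLs⟩ := hs.exists_append_flatten
  obtain rfl : d = Ls.length := by simpa [hsd] using (congrArg List.length hLs).symm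
  have hnd : Ls.Nodup := by
    refine List.Nodup.of_map List.head? (hLs ▸ ?_)
    exact (hsp.imp fun h => ne_of_gt h).map _ fun _ _ h => (Option.some_injective _).ne h
  have hprod : ∀ (ρ : Equiv.Perm (Fin n)) (r : Fin n → A),
      (List.ofFn (r ∘ ρ)).prod = ((List.ofFn ρ).map r).prod := fun ρ r => by rw [List.map_ofFn]
  -- the permutation whose word is obtained by rearranging the blocks
  have hword : ∀ σ : Equiv.Perm (Fin Ls.length), ∃ ρ : Equiv.Perm (Fin n),
      List.ofFn ρ = u ++ (List.ofFn (Ls.get ∘ σ)).flatten := by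
    intro σ
    have hp : (u ++ (List.ofFn (Ls.get ∘ σ)).flatten).Perm (List.ofFn π) := by
      rw [hπ]
      refine List.Perm.append_left _ (List.Perm.flatten ?_)
      simpa using Equiv.Perm.ofFn_comp_perm σ Ls.get
    exact List.exists_perm_ofFn_eq (hp.nodup_iff.mpr (List.nodup_ofFn.mpr π.injective))
      (by simpa using hp.length_eq)
  choose ρ hρ using hword
  have hlt : ∀ σ : Equiv.Perm (Fin Ls.length), σ ≠ 1 → List.ofFn (ρ σ) < List.ofFn π := by
    intro σ hσ
    rw [hρ, hπ]
    refine List.append_left_lt (List.Perm.flatten_lt hsp hLs ?_ fun h => hσ ?_)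
    · simpa using Equiv.Perm.ofFn_comp_perm σ Ls.get
    · have h' := List.ofFn_injective (h.trans (List.ofFn_get Ls).symm)
      exact Equiv.ext fun i => hnd.injective_get (congrFun h' i)
  have hsum : ∀ r : Fin n → A, ∑ σ, c σ • (List.ofFn (r ∘ ρ σ)).prod = 0 := by
    intro r
    have h := congrArg ((u.map r).prod * ·) (hc fun j => ((Ls.get j).map r).prod)
    simp only [Finset.mul_sum, mul_zero, mul_smul_comm] at h
    refine (Finset.sum_congr rfl fun σ _ => ?_).trans h
    rw [hprod, hρ, List.map_append, List.prod_append, List.map_flatten, List.prod_flatten]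
    simp [List.map_ofFn, Function.comp_def]
  have h1 : ρ 1 = π := DFunLike.coe_injective (List.ofFn_injective ((hρ 1).trans (by
    simpa using hπ.symm)))
  have key : (fun r : Fin n → A => (List.ofFn (r ∘ π)).prod) =
      -(c 1)⁻¹ • ∑ σ ∈ Finset.univ.erase 1,
        c σ • fun r : Fin n → A => (List.ofFn (r ∘ ρ σ)).prod := by
    funext r
    have h := hsum r
    rw [← Finset.add_sum_erase _ _ (Finset.mem_univ 1), h1, add_eq_zero_iff_eq_neg] at h
    simp only [Pi.smul_apply, Finset.sum_apply, neg_smul, ← smul_neg, ← h]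
    rw [smul_smul, inv_mul_cancel₀ hc1, one_smul]
  rw [key]
  exact Submodule.smul_mem _ _ (Submodule.sum_mem _ fun σ hσ =>
    Submodule.smul_mem _ _ (ih _ (hlt σ (Finset.ne_of_mem_erase hσ))))

theorem List.prod_ofFn_tmul {K A B : Type*} [CommSemiring K] [Semiring A] [Algebra K A] [Semiring B]
    [Algebra K B] {n : ℕ} (b : Fin n → B) (a : Fin n → A) :
    (List.ofFn fun i => b i ⊗ₜ[K] a i).prod = (List.ofFn b).prod ⊗ₜ (List.ofFn a).prod := by
  induction n with
  | zero => simp [Algebra.TensorProduct.one_def]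
  | succ n ih => simp [List.ofFn_succ, ih]

/-- Factorials outgrow exponentials. -/
theorem exists_mul_pow_lt_factorial (D C : ℕ) : ∃ n : ℕ, D * C ^ n < n.factorial := by
  have h := (FloorSemiring.tendsto_pow_div_factorial_atTop (C : ℝ)).eventually
    (gt_mem_nhds (show (0 : ℝ) < 1 / (D + 1) by positivity))
  obtain ⟨n, hn⟩ := h.exists
  refine ⟨n, ?_⟩
  rw [div_lt_div_iff₀ (by positivity) (by positivity), one_mul] at hn
  have : C ^ n * (D + 1) < n.factorial := by exact_mod_cast hn
  nlinarith [Nat.zero_le (C ^ n)]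

/-- A tensor product of a PI-algebra `A` with a finite-dimensional algebra `B` is a PI-algebra.
Expanding the arguments of a multilinear polynomial of degree `n` along a basis of `B` and reducing
the monomials in `A` to `d`-good ones, the polynomial vanishes on `B ⊗ A` as soon as its `n!`
coefficients satisfy a homogeneous linear system, whose number of equations is bounded by an
exponential in `n`. For large `n` the system has a nonzero solution. -/
theorem IsPIAlgebra.tensorProduct {K A B : Type*} [Field K] [Ring A] [Algebra K A]
    [Ring B] [Algebra K B] [FiniteDimensional K B] (h : IsPIAlgebra K A) :
    IsPIAlgebra K (B ⊗[K] A) := by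
  classical
  obtain ⟨d, c, hc1, hc⟩ := h.exists_isMultilinearIdentity
  set k := Module.finrank K B
  let β := Module.finBasis K B
  obtain ⟨n, hn⟩ := exists_mul_pow_lt_factorial k (k * d ^ 2)
  let G := {τ : Equiv.Perm (Fin n) // (List.ofFn τ).IsGood d}
  have hspan := fun π => (Submodule.mem_span_range_iff_exists_fun K).mp (hc.prod_mem_span hc1 n π)
  choose a ha using hspan
  replace ha : ∀ (π : Equiv.Perm (Fin n)) (r : Fin n → A),
      (List.ofFn (r ∘ π)).prod = ∑ τ : G, a π τ • (List.ofFn (r ∘ τ.1)).prod := fun π r => by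
    simpa using (congrFun (ha π) r).symm
  -- `Φ x (e, τ)` collects what multiplies the good monomial `τ` when the `i`-th argument is
  -- restricted to its component along the basis vector `β (e i)`
  let Φ : (Equiv.Perm (Fin n) → K) →ₗ[K] ((Fin n → Fin k) × G → B) :=
    LinearMap.pi fun p => ∑ π, (LinearMap.proj π).smulRight
      (a π p.2 • (List.ofFn ((β ∘ p.1) ∘ π)).prod)
  obtain ⟨x, hx, hx0⟩ : ∃ x, Φ x = 0 ∧ x ≠ 0 := by
    have hker : LinearMap.ker Φ ≠ ⊥ := by
      refine LinearMap.ker_ne_bot_of_finrank_lt ?_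
      rw [Module.finrank_pi_fintype, Module.finrank_pi]
      simp only [Finset.sum_const, Finset.card_univ, Fintype.card_prod, Fintype.card_fun,
        Fintype.card_fin, Fintype.card_perm, smul_eq_mul]
      calc k ^ n * Fintype.card G * k ≤ k ^ n * (d ^ 2) ^ n * k := by
            gcongr
            exact card_isGood_perm_le n d
        _ = k * (k * d ^ 2) ^ n := by rw [mul_pow]; ring
        _ < n.factorial := hn
    obtain ⟨x, hx, hx0⟩ := Submodule.exists_mem_ne_zero_of_ne_bot hker
    exact ⟨x, hx, hx0⟩
  refine IsMultilinearIdentity.isPIAlgebra hx0 fun y => ?_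
  have hx' : ∀ (e : Fin n → Fin k) (τ : G),
      ∑ π, (x π * a π τ) • (List.ofFn ((β ∘ e) ∘ π)).prod = 0 := fun e τ => by
    simpa [Φ, smul_smul] using congrFun hx (e, τ)
  -- expand every argument along the basis of `B`
  have hy : ∀ z : B ⊗[K] A, ∃ r : Fin k → A, z = ∑ j, β j ⊗ₜ r j := by
    intro z
    obtain ⟨c, rfl⟩ := TensorProduct.eq_repr_basis_left β z
    exact ⟨c, Finsupp.sum_fintype _ _ fun _ => TensorProduct.tmul_zero _ _⟩
  choose r hr using fun i => hy (y i)
  have hexp : ∀ π : Equiv.Perm (Fin n), (List.ofFn (y ∘ π)).prod =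
      ∑ e : Fin n → Fin k, (List.ofFn ((β ∘ e) ∘ π)).prod ⊗ₜ[K]
        (List.ofFn ((fun i => r i (e i)) ∘ π)).prod := by
    intro π
    have : y ∘ π = fun i => ∑ j, β j ⊗ₜ[K] r (π i) j := funext fun i => hr (π i)
    -- reindexing by `π` makes `e` depend on the arguments rather than on the positions
    rw [this, List.prod_ofFn_sum, ← (Equiv.arrowCongr π.symm (Equiv.refl (Fin k))).sum_comp]
    refine Finset.sum_congr rfl fun e _ => ?_
    rw [List.prod_ofFn_tmul]
    rfl
  simp_rw [hexp, Finset.smul_sum]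
  rw [Finset.sum_comm]
  refine Finset.sum_eq_zero fun e _ => ?_
  rw [Finset.sum_congr rfl fun π _ => by rw [ha π, TensorProduct.tmul_sum, Finset.smul_sum],
    Finset.sum_comm]
  refine Finset.sum_eq_zero fun τ _ => ?_
  have h := congrArg (· ⊗ₜ[K] (List.ofFn ((fun i => r i (e i)) ∘ τ.1)).prod) (hx' e τ)
  simpa only [TensorProduct.sum_tmul, TensorProduct.zero_tmul, TensorProduct.tmul_smul,
    ← TensorProduct.smul_tmul', smul_smul] using h

theorem IsPIAlgebra.of_algEquiv {K A B : Type*} [Field K] [Ring A] [Algebra K A]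
    [Ring B] [Algebra K B] (e : A ≃ₐ[K] B) (h : IsPIAlgebra K A) : IsPIAlgebra K B := by
  obtain ⟨f, hf, hA⟩ := h
  refine ⟨f, hf, fun b => ?_⟩
  have h : FreeAlgebra.lift K b = e.toAlgHom.comp (FreeAlgebra.lift K (e.symm ∘ b)) := by
    ext x
    simp
  rw [h]
  simp [hA]

theorem IsPIAlgebra.matrix {K A : Type*} [Field K] [Ring A] [Algebra K A] (h : IsPIAlgebra K A)
    (ι : Type*) [Fintype ι] [DecidableEq ι] : IsPIAlgebra K (Matrix ι ι A) :=
  (h.tensorProduct (B := Matrix ι ι K)).of_algEquiv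
    ((Algebra.TensorProduct.comm K _ _).trans (matrixEquivTensor ι K A).symm)

/-! ### Truncated skew polynomial algebras -/

section
variable {K R : Type*} [Field K] [Ring R] [Algebra K R]

/-- The embedding of `R` into `R[w, σ]` as the constant polynomials. -/
noncomputable def SkewPolyAlg.constAlgHom (σ : R →ₐ[K] R) : R →ₐ[K] SkewPolyAlg σ where
  __ := (SkewPolynomial.CRingHom (R := TwistedBy σ)).comp (TwistedBy.of σ).toRingEquiv.toRingHom
  commutes' _ := rfl

theorem SkewPolynomial.monomial_mem_span_X_pow {S : Type*} [Ring S]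
    [MulSemiringAction (Multiplicative ℕ) S]
    {t m : ℕ} (h : t ≤ m) (a : S) :
    SkewPolynomial.monomial m a ∈
      TwoSidedIdeal.span {(SkewPolynomial.X ^ t : SkewPolynomial S)} := by
  obtain ⟨j, rfl⟩ := Nat.exists_eq_add_of_le' h
  rw [← SkewPolynomial.monomial_mul_X_pow]
  exact TwoSidedIdeal.mul_mem_left _ _ _ (TwoSidedIdeal.subset_span rfl)

/-- The additive group of skew polynomials all of whose monomials have degree at least `t`. -/
noncomputable def SkewPolynomial.orderGE (S : Type*) [Ring S] (t : ℕ) :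
    AddSubgroup (SkewPolynomial S) :=
  AddSubgroup.closure {p | ∃ m a, t ≤ m ∧ SkewPolynomial.monomial m a = p}

theorem SkewPolynomial.orderGE_le_span {S : Type*} [Ring S]
    [MulSemiringAction (Multiplicative ℕ) S]
    {t : ℕ} {p : SkewPolynomial S} (hp : p ∈ SkewPolynomial.orderGE S t) :
    p ∈ TwoSidedIdeal.span {(SkewPolynomial.X ^ t : SkewPolynomial S)} := by
  induction hp using AddSubgroup.closure_induction with
  | mem p hp =>
    obtain ⟨m, a, h, rfl⟩ := hp
    exact monomial_mem_span_X_pow h a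
  | zero => exact zero_mem _
  | add _ _ _ _ h1 h2 => exact add_mem h1 h2
  | neg _ _ h => exact neg_mem h

theorem SkewPolynomial.mul_mem_orderGE {S : Type*} [Ring S]
    [MulSemiringAction (Multiplicative ℕ) S]
    {i j : ℕ} {p q : SkewPolynomial S} (hp : p ∈ SkewPolynomial.orderGE S i)
    (hq : q ∈ SkewPolynomial.orderGE S j) : p * q ∈ SkewPolynomial.orderGE S (i + j) := by
  induction hp using AddSubgroup.closure_induction with
  | zero => simp
  | add _ _ _ _ h1 h2 => rw [add_mul]; exact add_mem h1 h2
  | neg _ _ h => rw [neg_mul]; exact neg_mem h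
  | mem p hp =>
    obtain ⟨m, a, hm, rfl⟩ := hp
    induction hq using AddSubgroup.closure_induction with
    | zero => simp
    | add _ _ _ _ h1 h2 => rw [mul_add]; exact add_mem h1 h2
    | neg _ _ h => rw [mul_neg]; exact neg_mem h
    | mem q hq =>
      obtain ⟨n, b, hn, rfl⟩ := hq
      exact AddSubgroup.subset_closure
        ⟨m + n, _, Nat.add_le_add hm hn, (monomial_mul_monomial m n a b).symm⟩

theorem SkewPolynomial.mem_orderGE_zero {S : Type*} [Ring S] (p : SkewPolynomial S) :
    p ∈ SkewPolynomial.orderGE S 0 := by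
  induction p using SkewPolynomial.induction with
  | h0 => exact zero_mem _
  | ha n r q _ _ h => exact add_mem (AddSubgroup.subset_closure ⟨n, r, Nat.zero_le _, rfl⟩) h

theorem SkewPolynomial.exists_sub_C_mem_orderGE {S : Type*} [Ring S] (p : SkewPolynomial S) :
    ∃ r, p - SkewPolynomial.C r ∈ SkewPolynomial.orderGE S 1 := by
  induction p using SkewPolynomial.induction with
  | h0 => exact ⟨0, by simp⟩
  | ha n r q _ _ h =>
    obtain ⟨s, hs⟩ := h
    rcases Nat.eq_zero_or_pos n with rfl | hn
    · exact ⟨r + s, by simpa using hs⟩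
    · exact ⟨s, by
        rw [add_sub_assoc]
        exact add_mem (AddSubgroup.subset_closure ⟨n, r, hn, rfl⟩) hs⟩

theorem SkewPolynomial.pow_mem_orderGE {S : Type*} [Ring S]
    [MulSemiringAction (Multiplicative ℕ) S]
    {p : SkewPolynomial S} (hp : p ∈ SkewPolynomial.orderGE S 1) (t : ℕ) :
    p ^ t ∈ SkewPolynomial.orderGE S t := by
  induction t with
  | zero => exact mem_orderGE_zero _
  | succ t ih => rw [pow_succ]; exact mul_mem_orderGE ih hp

/-- A noncommutative polynomial takes congruent values at arguments that are congruent modulo a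
two-sided ideal. -/
theorem FreeAlgebra.lift_sub_lift_mem {K A X : Type*} [CommRing K] [Ring A] [Algebra K A]
    (I : TwoSidedIdeal A) (a b : X → A) (h : ∀ x, a x - b x ∈ I) (f : FreeAlgebra K X) :
    FreeAlgebra.lift K a f - FreeAlgebra.lift K b f ∈ I := by
  have : (I.ringCon.mkₐ K).comp (FreeAlgebra.lift K a) =
      (I.ringCon.mkₐ K).comp (FreeAlgebra.lift K b) := by
    ext x
    simpa using I.ringCon.eq.mpr ((I.rel_iff _ _).mpr (h x))
  exact (I.rel_iff _ _).mp (I.ringCon.eq.mp (congrArg (fun g => g f) this))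

theorem SkewPolynomial.mem_orderGE_one_of_mem_span_X {S : Type*} [Ring S]
    [MulSemiringAction (Multiplicative ℕ) S] {p : SkewPolynomial S}
    (hp : p ∈ TwoSidedIdeal.span {(SkewPolynomial.X : SkewPolynomial S)}) :
    p ∈ SkewPolynomial.orderGE S 1 := by
  induction hp using TwoSidedIdeal.span_induction with
  | mem x h =>
    obtain rfl := h
    exact AddSubgroup.subset_closure ⟨1, 1, le_rfl, rfl⟩
  | zero => exact zero_mem _
  | add _ _ _ _ h1 h2 => exact add_mem h1 h2
  | neg _ _ h => exact neg_mem h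
  | left_absorb a x _ h => simpa using mul_mem_orderGE (mem_orderGE_zero a) h
  | right_absorb b x _ h => simpa using mul_mem_orderGE h (mem_orderGE_zero b)

/-- If `f` is an identity of `R`, then `f ^ t` is an identity of `R[w, σ] / (w ^ t)`: modulo `w`
the values of `f` are values on constant polynomials, which vanish. -/
theorem IsPIAlgebra.truncSkewPolyAlg (σ : R →ₐ[K] R) (t : ℕ) (hR : IsPIAlgebra K R) :
    IsPIAlgebra K (TruncSkewPolyAlg σ t) := by
  obtain ⟨f, hf, hR⟩ := hR
  refine ⟨f ^ t, pow_ne_zero t hf, fun a => ?_⟩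
  set I := TwoSidedIdeal.span {(SkewPolynomial.X ^ t : SkewPolyAlg σ)}
  choose p hp using fun i => RingCon.mkₐ_surjective (α := K) I.ringCon (a i)
  choose r hr using fun i => SkewPolynomial.exists_sub_C_mem_orderGE (p i)
  have hlift : FreeAlgebra.lift K a = (I.ringCon.mkₐ K).comp (FreeAlgebra.lift K p) := by
    ext i
    simpa using (hp i).symm
  have hconst :
      FreeAlgebra.lift K (SkewPolyAlg.constAlgHom σ ∘ (TwistedBy.of σ).symm ∘ r) f = 0 := by
    have : FreeAlgebra.lift K (SkewPolyAlg.constAlgHom σ ∘ (TwistedBy.of σ).symm ∘ r) =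
        (SkewPolyAlg.constAlgHom σ).comp (FreeAlgebra.lift K ((TwistedBy.of σ).symm ∘ r)) := by
      ext i
      simp
    rw [this, AlgHom.comp_apply, hR, map_zero]
  have hmem : FreeAlgebra.lift K p f ∈ SkewPolynomial.orderGE (TwistedBy σ) 1 := by
    have := FreeAlgebra.lift_sub_lift_mem (TwoSidedIdeal.span {(SkewPolynomial.X : SkewPolyAlg σ)})
      p (SkewPolyAlg.constAlgHom σ ∘ (TwistedBy.of σ).symm ∘ r)
      (fun i => by
        have := SkewPolynomial.orderGE_le_span (hr i)
        rwa [pow_one] at this) f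
    rw [hconst, sub_zero] at this
    exact SkewPolynomial.mem_orderGE_one_of_mem_span_X this
  rw [hlift, AlgHom.comp_apply, map_pow]
  have := SkewPolynomial.orderGE_le_span (SkewPolynomial.pow_mem_orderGE hmem t)
  exact I.ringCon.eq.mpr ((I.mem_iff _).mp this)
end

theorem mainTheorem6 {K R : Type*} [Field K] [Ring R] [Algebra K R]
    (σ : R →ₐ[K] R) (t : ℕ) (ht : 1 ≤ t) (hσ : σ ^ t = 1) (hR : IsPIAlgebra K R) :
    (∀ n : ℕ, 1 ≤ n → IsPIAlgebra K (Matrix (Fin n) (Fin n) (TruncSkewPolyAlg σ t))) ∧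
      IsPIAlgebra K (TruncSkewPolyAlg σ t) := by
  have hA := hR.truncSkewPolyAlg σ t
  exact ⟨fun n _ => hA.matrix (Fin n), hA⟩
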